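/- Let $G$ be a second countable, locally compact, Hausdorff topological groupoid with unit space $G^0$, domain map $d(x)=x^{-1}x$ and range map $r(x)=xx^{-1}$. Let $\mathcal H=\{\mathcal H_u\}_{u\in G^0}$ be a continuous field of separable Hilbert spaces whose space $C_0(G^0,\mathcal H)$ of continuous sections vanishing at infinity is a countably generated Hilbert $C_0(G^0)$-module, and let $\pi$ be a continuous unitary representation of $G$ on $\mathcal H$: unitaries $\pi(x):\mathcal H_{d(x)}\to\mathcal H_{r(x)}$ with $\pi(u)=\mathrm{id}$ for $u\in G^0$, $\pi(x)\pi(y)=\pi(xy)$ for composable $x,y$, $\pi(x)^{-1}=\pi(x^{-1})$, and $x\mapsto\langle\pi(x)\xi(d(x)),\eta(r(x))\rangle$ continuous for all $\xi,\eta\in C_0(G^0,\mathcal H)$. For an adjointable operator $T$ on $C_0(G^0,\mathcal H)$ let $T_u$ denote its localization on $\mathcal H_u$, so that $T_u\xi(u)=(T\xi)(u)$. Call $T$ Hilbert–Schmidt if $u\mapsto \mathrm{Tr}\,|T_u|^2$ is finite and lies in $C_0(G^0)$, and put $\|T\|_2=\sup_u\|T_u\|_2$. The representation $\pi$ is called amenable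 if there is a net $(T^i)$ of Hilbert–Schmidt operators on $C_0(G^0,\mathcal H)$ such that $\|T^i\|_2\le 1$ for all $i$, $\|T^i_u\|_2\to 1$ uniformly on compact subsets of $G^0$, and $\langle \pi(x)T^i_{d(x)}\pi(x^{-1}),T^i_{r(x)}\rangle\to 1$ uniformly on compact subsets of $G$, where $\langle A,B\rangle=\mathrm{Tr}(B^*A)$. The same definitions are used for every closed subgroupoid of $G$. If $\pi$ is amenable and $H$ is a closed subgroupoid of $G$ with unit space $H^0\subseteq G^0$ (not necessarily all of $G^0$), then the restriction $\pi|_H$, acting on the reduction $\mathcal H|_{H^0}$ of $\mathcal H$ to $H^0$, is an amenable representation of $H$; in particular $C_0(H^0,\mathcal H|_{H^0})$ is again a countably generated Hilbert $C_0(H^0)$-module. -/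

import Mathlib

open Filter Topology Set
open scoped ENNReal InnerProductSpace ZeroAtInfty

universe u v

/-! ### Topological groupoids -/

/-- A topological groupoid: a set `G` with a product defined on the set of composable pairs, and an
inverse map, both continuous (the composable pairs carry the topology of `G × G`). -/
class TopGroupoid (G : Type u) [TopologicalSpace G] where
  /-- `(x, y)` is a composable pair -/
  Comp : G → G → Prop
  /-- the partial product -/
  mul : ∀ x y : G, Comp x y → G
  /-- the inverse map -/
  inv : G → G
  inv_inv : ∀ x, inv (inv x) = x
  comp_left : ∀ {x y z : G} (hxy : Comp x y), Comp y z → Comp (mul x y hxy) z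
  comp_right : ∀ {x y z : G}, Comp x y → ∀ hyz : Comp y z, Comp x (mul y z hyz)
  mul_assoc : ∀ {x y z : G} (hxy : Comp x y) (hyz : Comp y z),
    mul (mul x y hxy) z (comp_left hxy hyz) = mul x (mul y z hyz) (comp_right hxy hyz)
  comp_inv_left : ∀ x, Comp (inv x) x
  inv_mul_cancel_left : ∀ {x y : G} (hxy : Comp x y),
    mul (inv x) (mul x y hxy) (comp_right (comp_inv_left x) hxy) = y
  comp_inv_right : ∀ x, Comp x (inv x)
  mul_inv_cancel_right : ∀ {z x : G} (hzx : Comp z x),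
    mul (mul z x hzx) (inv x) (comp_left hzx (comp_inv_right x)) = z
  continuous_inv : Continuous inv
  continuous_mul : Continuous fun p : {p : G × G // Comp p.1 p.2} => mul p.1.1 p.1.2 p.2

namespace TopGroupoid

section Basic

variable {G : Type u} [TopologicalSpace G] [TopGroupoid G]

/-- The element `x⁻¹ x` of `G`. -/
def domElt (x : G) : G := mul (inv x) x (comp_inv_left x)

/-- The element `x x⁻¹` of `G`. -/
def ranElt (x : G) : G := mul x (inv x) (comp_inv_right x)

variable (G) in
/-- The unit space `G⁰ = {x⁻¹ x | x ∈ G} = {x x⁻¹ | x ∈ G}`, a subspace of `G`. -/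
def unitSpace : Set G := Set.range domElt

theorem mul_congr {x x' y y' : G} (hx : x = x') (hy : y = y') (h : Comp x y) (h' : Comp x' y') :
    mul x y h = mul x' y' h' := by
  subst hx hy; rfl

theorem domElt_inv (x : G) : domElt (inv x) = ranElt x :=
  mul_congr (inv_inv x) rfl _ _

theorem ranElt_inv (x : G) : ranElt (inv x) = domElt x :=
  mul_congr rfl (inv_inv x) _ _

theorem ranElt_mem (x : G) : ranElt x ∈ unitSpace G := ⟨inv x, domElt_inv x⟩

theorem domElt_eq_ranElt {x y : G} (h : Comp x y) : domElt x = ranElt y := by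
  -- both sides equal `x⁻¹ x y y⁻¹`
  have hyy := comp_inv_right y
  have hxx := comp_inv_left x
  have e1 : mul (mul (inv x) (mul x y h) (comp_right hxx h)) (inv y)
      (comp_left (comp_right hxx h) (comp_left h hyy)) = ranElt y :=
    mul_congr (inv_mul_cancel_left h) rfl _ _
  have e2 := mul_assoc (comp_right hxx h) (comp_left h hyy)
  rw [← e1, e2]
  exact (mul_congr rfl (mul_inv_cancel_right h) _ _).symm

theorem domElt_mul {x y : G} (h : Comp x y) : domElt (mul x y h) = domElt y := by
  rw [domElt_eq_ranElt (comp_left h (comp_inv_right y)), ranElt_inv]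

theorem ranElt_mul {x y : G} (h : Comp x y) : ranElt (mul x y h) = ranElt x := by
  rw [← domElt_eq_ranElt (comp_right (comp_inv_left x) h), domElt_inv]

theorem domElt_domElt (x : G) : domElt (domElt x) = domElt x := domElt_mul _

theorem ranElt_domElt (x : G) : ranElt (domElt x) = domElt x :=
  (ranElt_mul _).trans (ranElt_inv x)

/-- The domain map `d : G → G⁰`, `d x = x⁻¹ x`. -/
def dom (x : G) : unitSpace G := ⟨domElt x, x, rfl⟩

/-- The range map `r : G → G⁰`, `r x = x x⁻¹`. -/
def ran (x : G) : unitSpace G := ⟨ranElt x, ranElt_mem x⟩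

theorem dom_inv (x : G) : dom (inv x) = ran x := Subtype.ext (domElt_inv x)

theorem ran_inv (x : G) : ran (inv x) = dom x := Subtype.ext (ranElt_inv x)

theorem dom_mul {x y : G} (h : Comp x y) : dom (mul x y h) = dom y := Subtype.ext (domElt_mul h)

theorem ran_mul {x y : G} (h : Comp x y) : ran (mul x y h) = ran x := Subtype.ext (ranElt_mul h)

theorem dom_coe (w : unitSpace G) : dom (w : G) = w := by
  obtain ⟨_, x, rfl⟩ := w
  exact Subtype.ext (domElt_domElt x)

theorem ran_coe (w : unitSpace G) : ran (w : G) = w := by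
  obtain ⟨_, x, rfl⟩ := w
  exact Subtype.ext (ranElt_domElt x)

theorem continuous_domElt : Continuous (domElt : G → G) :=
  continuous_mul.comp
    (Continuous.subtype_mk (f := fun x : G => (inv x, x)) (continuous_inv.prodMk continuous_id)
      fun x => comp_inv_left x)

theorem continuous_dom : Continuous (dom : G → unitSpace G) :=
  continuous_domElt.subtype_mk _

theorem continuous_ran : Continuous (ran : G → unitSpace G) := by
  have : (ran : G → unitSpace G) = dom ∘ inv := funext fun x => (dom_inv x).symm
  rw [this]
  exact continuous_dom.comp continuous_inv

theorem isClosed_unitSpace [T2Space G] : IsClosed (unitSpace G) := by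
  have : unitSpace G = {x : G | domElt x = x} := by
    ext x
    constructor
    · rintro ⟨y, rfl⟩
      exact domElt_domElt y
    · intro h
      exact ⟨x, h⟩
  rw [this]
  exact isClosed_eq continuous_domElt continuous_id

instance [T2Space G] [LocallyCompactSpace G] : LocallyCompactSpace (unitSpace G) :=
  isClosed_unitSpace.locallyCompactSpace

end Basic

/-- A closed subgroupoid of `G`: a closed subset that is stable under products of composable pairs
and under inverses. Its unit space may be smaller than that of `G`. -/
structure ClosedSubgroupoid (G : Type u) [TopologicalSpace G] [TopGroupoid G] where
  carrier : Set G
  isClosed_carrier : IsClosed carrier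
  mul_mem : ∀ {x y : G}, x ∈ carrier → y ∈ carrier → ∀ h : Comp x y, mul x y h ∈ carrier
  inv_mem : ∀ {x : G}, x ∈ carrier → inv x ∈ carrier

namespace ClosedSubgroupoid

variable {G : Type u} [TopologicalSpace G] [TopGroupoid G]

instance : CoeSort (ClosedSubgroupoid G) (Type u) := ⟨fun H => H.carrier⟩

instance (H : ClosedSubgroupoid G) : TopGroupoid H where
  Comp x y := Comp (x : G) (y : G)
  mul x y h := ⟨mul (x : G) (y : G) h, H.mul_mem x.2 y.2 h⟩
  inv x := ⟨inv (x : G), H.inv_mem x.2⟩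
  inv_inv x := Subtype.ext (inv_inv (x : G))
  comp_left hxy hyz := comp_left hxy hyz
  comp_right hxy hyz := comp_right hxy hyz
  mul_assoc hxy hyz := Subtype.ext (mul_assoc hxy hyz)
  comp_inv_left x := comp_inv_left (x : G)
  inv_mul_cancel_left hxy := Subtype.ext (inv_mul_cancel_left hxy)
  comp_inv_right x := comp_inv_right (x : G)
  mul_inv_cancel_right h := Subtype.ext (mul_inv_cancel_right h)
  continuous_inv := (continuous_inv.comp continuous_subtype_val).subtype_mk _
  continuous_mul := by
    refine Continuous.subtype_mk ?_ _
    exact continuous_mul.comp (Continuous.subtype_mk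
      (f := fun p : {p : H.carrier × H.carrier // Comp (p.1 : G) (p.2 : G)} =>
        ((p.1.1 : G), (p.1.2 : G))) (by fun_prop) fun p => p.2)

instance [LocallyCompactSpace G] (H : ClosedSubgroupoid G) : LocallyCompactSpace H :=
  H.isClosed_carrier.locallyCompactSpace

/-- The inclusion `H⁰ → G⁰` of unit spaces. -/
def unitIncl (H : ClosedSubgroupoid G) (w : unitSpace H) : unitSpace G :=
  ⟨((w : H) : G), by
    obtain ⟨x, hx⟩ := w.2
    exact ⟨(x : G), congrArg Subtype.val hx⟩⟩

theorem continuous_unitIncl (H : ClosedSubgroupoid G) : Continuous H.unitIncl :=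
  (continuous_subtype_val.comp continuous_subtype_val).subtype_mk _

theorem unitIncl_dom (H : ClosedSubgroupoid G) (x : H) : H.unitIncl (dom x) = dom (x : G) := rfl

theorem unitIncl_ran (H : ClosedSubgroupoid G) (x : H) : H.unitIncl (ran x) = ran (x : G) := rfl

end ClosedSubgroupoid

end TopGroupoid

/-! ### Continuous fields of Hilbert spaces -/

/-- A continuous field of separable Hilbert spaces `E x`, `x ∈ X`, given by its space `sections` of
continuous sections. -/
structure ContinuousField (X : Type u) [TopologicalSpace X] (E : X → Type v)
    [∀ x, NormedAddCommGroup (E x)] [∀ x, InnerProductSpace ℂ (E x)]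
    [∀ x, CompleteSpace (E x)] [∀ x, TopologicalSpace.SeparableSpace (E x)] where
  sections : Submodule ℂ (∀ x, E x)
  dense_eval : ∀ x, Dense {w : E x | ∃ ξ ∈ sections, ξ x = w}
  continuous_norm : ∀ ξ ∈ sections, Continuous fun x => ‖ξ x‖
  mem_of_locally_approx : ∀ ξ : ∀ x, E x,
    (∀ x, ∀ ε > (0 : ℝ), ∃ ξ' ∈ sections, ∀ᶠ s in 𝓝 x, ‖ξ s - ξ' s‖ < ε) → ξ ∈ sections

namespace ContinuousField

variable {X : Type u} [TopologicalSpace X] {E : X → Type v}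
    [∀ x, NormedAddCommGroup (E x)] [∀ x, InnerProductSpace ℂ (E x)]
    [∀ x, CompleteSpace (E x)] [∀ x, TopologicalSpace.SeparableSpace (E x)]

/-- `C₀(X, E)`: the continuous sections whose norm vanishes at infinity. -/
def c0 (F : ContinuousField X E) : Submodule ℂ (∀ x, E x) where
  carrier := {ξ | ξ ∈ F.sections ∧ Tendsto (fun x => ‖ξ x‖) (cocompact X) (𝓝 0)}
  add_mem' := by
    rintro ξ η ⟨hξ, hξ0⟩ ⟨hη, hη0⟩
    refine ⟨F.sections.add_mem hξ hη, ?_⟩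
    refine squeeze_zero (fun x => norm_nonneg _) (fun x => norm_add_le (ξ x) (η x)) ?_
    simpa using hξ0.add hη0
  zero_mem' := ⟨F.sections.zero_mem, by simpa using tendsto_const_nhds⟩
  smul_mem' := by
    rintro c ξ ⟨hξ, hξ0⟩
    refine ⟨F.sections.smul_mem c hξ, ?_⟩
    simpa [norm_smul] using hξ0.const_mul ‖c‖

/-- The Hilbert `C₀(X)`-module `C₀(X, E)` is countably generated: for some sequence `e` of elements,
the finite combinations of the `e i` with coefficients in `C₀(X)` are dense for the sup norm. -/
def CountablyGenerated (F : ContinuousField X E) : Prop :=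
  ∃ e : ℕ → F.c0, ∀ ξ : F.c0, ∀ ε > (0 : ℝ), ∃ (N : ℕ) (f : ℕ → C₀(X, ℂ)),
    ∀ x, ‖(ξ : ∀ x, E x) x - ∑ i ∈ Finset.range N, f i x • (e i : ∀ x, E x) x‖ ≤ ε

theorem smul_mem_sections (F : ContinuousField X E) {φ : X → ℂ} (hφ : Continuous φ)
    {ξ : ∀ x, E x} (hξ : ξ ∈ F.sections) : (fun x => φ x • ξ x) ∈ F.sections := by
  refine F.mem_of_locally_approx _ fun x ε hε => ⟨φ x • ξ, F.sections.smul_mem _ hξ, ?_⟩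
  have hc : Continuous fun s => ‖φ s - φ x‖ * ‖ξ s‖ :=
    (hφ.sub continuous_const).norm.mul (F.continuous_norm ξ hξ)
  have h0 : ‖φ x - φ x‖ * ‖ξ x‖ < ε := by simpa using hε
  filter_upwards [hc.continuousAt.eventually_lt continuousAt_const h0] with s hs
  simpa [← sub_smul, norm_smul] using hs

/-- Every continuous section agrees near a given point with one that vanishes at infinity. -/
theorem exists_c0_eventuallyEq [T2Space X] [LocallyCompactSpace X] (F : ContinuousField X E)
    {ξ : ∀ x, E x} (hξ : ξ ∈ F.sections) (x : X) :
    ∃ ξ' ∈ F.c0, ∀ᶠ s in 𝓝 x, ξ' s = ξ s := by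
  obtain ⟨K, hK, hxK⟩ := exists_compact_mem_nhds x
  obtain ⟨f, hf1, -, hfc, -⟩ := exists_continuous_one_zero_of_isCompact hK isClosed_empty
    (disjoint_empty K)
  have hcont : Continuous fun s => ((f s : ℝ) : ℂ) := Complex.continuous_ofReal.comp f.continuous
  refine ⟨fun s => ((f s : ℝ) : ℂ) • ξ s, ⟨F.smul_mem_sections hcont hξ, ?_⟩, ?_⟩
  · refine tendsto_const_nhds.congr' ?_
    filter_upwards [hfc.isCompact.compl_mem_cocompact] with s hs
    simp [image_eq_zero_of_notMem_tsupport hs]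
  · filter_upwards [hxK] with s hs
    simp [hf1 hs]

/-- A continuous section through `w` whose norm is bounded by `‖w‖`, if `w` is a value of some
continuous section. -/
theorem exists_bounded_section (F : ContinuousField X E) (x : X) {w : E x}
    (hw : ∃ ξ ∈ F.sections, ξ x = w) :
    ∃ ξ ∈ F.sections, ξ x = w ∧ ∀ s, ‖ξ s‖ ≤ ‖w‖ := by
  obtain ⟨ξ, hξ, rfl⟩ := hw
  by_cases h0 : ξ x = 0
  · exact ⟨0, F.sections.zero_mem, by simp [h0], by simp⟩
  have hpos : 0 < ‖ξ x‖ := norm_pos_iff.2 h0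
  have hm : ∀ s, 0 < max ‖ξ x‖ ‖ξ s‖ := fun s => lt_max_of_lt_left hpos
  have hcont : Continuous fun s => ((‖ξ x‖ / max ‖ξ x‖ ‖ξ s‖ : ℝ) : ℂ) :=
    Complex.continuous_ofReal.comp (continuous_const.div
      (continuous_const.max (F.continuous_norm ξ hξ)) fun s => (hm s).ne')
  refine ⟨_, F.smul_mem_sections hcont hξ, ?_, fun s => ?_⟩
  · simp [hpos.ne']
  · rw [norm_smul, Complex.norm_real, Real.norm_of_nonneg (by positivity), div_mul_eq_mul_div,
      div_le_iff₀ (hm s)]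
    exact mul_le_mul_of_nonneg_left (le_max_right _ _) hpos.le

/-- Every vector of a fibre is the value of a continuous section. -/
theorem exists_section_eval (F : ContinuousField X E) (x : X) (w : E x) :
    ∃ ξ ∈ F.sections, ξ x = w := by
  let S : AddSubgroup (E x) :=
    (F.sections.map (LinearMap.proj x : (∀ x, E x) →ₗ[ℂ] E x)).toAddSubgroup
  have hS : ∀ {w : E x}, w ∈ S ↔ ∃ ξ ∈ F.sections, ξ x = w := by
    intro w; simp [S]
  have hmem : w ∈ closure (S : Set (E x)) := by
    have hd := F.dense_eval x w
    refine closure_mono ?_ hd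
    intro w' hw'
    exact hS.2 hw'
  obtain ⟨a, ha, haS, -, hab⟩ := controlled_sum_of_mem_closure hmem
    (b := fun n => (1 / 2 : ℝ) ^ n) (fun n => by positivity)
  choose η hη hηx hηb using fun n => F.exists_bounded_section x (hS.1 (haS n))
  have hsum : Summable fun n => ‖a n‖ := by
    refine (summable_nat_add_iff 1).1 ?_
    refine Summable.of_nonneg_of_le (fun n => norm_nonneg _)
      (fun n => (hab (n + 1) n.succ_pos).le) ?_
    exact (summable_nat_add_iff (f := fun n => (1 / 2 : ℝ) ^ n) 1).2 summable_geometric_two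
  have hsn : ∀ s, Summable fun n => ‖η n s‖ := fun s =>
    Summable.of_nonneg_of_le (fun n => norm_nonneg _) (fun n => hηb n s) hsum
  refine ⟨fun s => ∑' n, η n s, F.mem_of_locally_approx _ fun y ε hε => ?_, ?_⟩
  · have ht := tendsto_sum_nat_add fun n => ‖a n‖
    obtain ⟨N, hN⟩ := (ht.eventually (gt_mem_nhds hε)).exists
    refine ⟨∑ n ∈ Finset.range N, η n, F.sections.sum_mem fun n _ => hη n,
      Eventually.of_forall fun s => ?_⟩
    have e := (hsn s).of_norm.sum_add_tsum_nat_add N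
    rw [Finset.sum_apply, ← e, add_sub_cancel_left]
    refine lt_of_le_of_lt ?_ hN
    exact tsum_of_norm_bounded ((summable_nat_add_iff N).2 hsum).hasSum fun n => hηb (n + N) s
  · have h1 : Tendsto (fun n => ∑ i ∈ Finset.range (n + 1), η i x) atTop (𝓝 (∑' n, η n x)) :=
      (tendsto_add_atTop_iff_nat 1).2 (hsn x).of_norm.hasSum.tendsto_sum_nat
    refine tendsto_nhds_unique h1 ?_
    simpa [hηx] using ha

theorem exists_c0_eval [T2Space X] [LocallyCompactSpace X] (F : ContinuousField X E) (x : X)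
    (w : E x) : ∃ ξ : F.c0, (ξ : ∀ x, E x) x = w := by
  obtain ⟨ξ, hξ, rfl⟩ := F.exists_section_eval x w
  obtain ⟨ξ', hξ', h⟩ := F.exists_c0_eventuallyEq hξ x
  exact ⟨⟨ξ', hξ'⟩, h.self_of_nhds⟩

/-- The pullback of a continuous field along a continuous map `f : Y → X`; for the inclusion of a
subspace this is the reduction of the field to the subspace. Its fibre over `y` is `E (f y)`. A
section is continuous, i.e. continuous into the total space of the field, if and only if it is
locally a uniform limit of continuous sections of the given field. -/
def pullback (F : ContinuousField X E) {Y : Type u} [TopologicalSpace Y] (f : Y → X)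
    (hf : Continuous f) : ContinuousField Y fun y => E (f y) where
  sections :=
    { carrier := {ξ | ∀ y, ∀ ε > (0 : ℝ), ∃ ξ' ∈ F.sections, ∀ᶠ s in 𝓝 y, ‖ξ s - ξ' (f s)‖ < ε}
      add_mem' := by
        intro ξ η hξ hη y ε hε
        obtain ⟨ξ', hξ', h1⟩ := hξ y (ε / 2) (half_pos hε)
        obtain ⟨η', hη', h2⟩ := hη y (ε / 2) (half_pos hε)
        refine ⟨ξ' + η', F.sections.add_mem hξ' hη', ?_⟩
        filter_upwards [h1, h2] with s hs1 hs2
        calc ‖(ξ s + η s) - (ξ' (f s) + η' (f s))‖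
            = ‖(ξ s - ξ' (f s)) + (η s - η' (f s))‖ := by congr 1; abel
          _ ≤ _ := norm_add_le _ _
          _ < ε := by linarith
      zero_mem' := fun y ε hε => ⟨0, F.sections.zero_mem, by simpa using hε⟩
      smul_mem' := by
        intro c ξ hξ y ε hε
        have hc : 0 < ‖c‖ + 1 := by positivity
        obtain ⟨ξ', hξ', h1⟩ := hξ y (ε / (‖c‖ + 1)) (by positivity)
        refine ⟨c • ξ', F.sections.smul_mem c hξ', ?_⟩
        filter_upwards [h1] with s hs
        rw [lt_div_iff₀ hc] at hs
        calc ‖c • ξ s - c • ξ' (f s)‖ = ‖c‖ * ‖ξ s - ξ' (f s)‖ := by rw [← smul_sub, norm_smul]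
          _ ≤ ‖ξ s - ξ' (f s)‖ * (‖c‖ + 1) := by nlinarith [norm_nonneg (ξ s - ξ' (f s))]
          _ < ε := hs }
  dense_eval := by
    intro y
    refine (F.dense_eval (f y)).mono ?_
    rintro w ⟨ξ, hξ, rfl⟩
    exact ⟨fun s => ξ (f s), fun y ε hε => ⟨ξ, hξ, by simpa using hε⟩, rfl⟩
  continuous_norm := by
    intro ξ hξ
    refine continuous_of_locally_uniform_approx_of_continuousAt fun y U hU => ?_
    obtain ⟨ε, hε, hεU⟩ := Metric.mem_uniformity_dist.1 hU
    obtain ⟨ξ', hξ', h⟩ := hξ y ε hε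
    refine ⟨_, h, fun s => ‖ξ' (f s)‖,
      ((F.continuous_norm ξ' hξ').comp hf).continuousAt, fun s hs => hεU ?_⟩
    rw [Real.dist_eq]
    exact (abs_norm_sub_norm_le _ _).trans_lt hs
  mem_of_locally_approx := by
    intro ξ hξ y ε hε
    obtain ⟨η, hη, h1⟩ := hξ y (ε / 2) (half_pos hε)
    obtain ⟨ξ', hξ', h2⟩ := hη y (ε / 2) (half_pos hε)
    refine ⟨ξ', hξ', ?_⟩
    filter_upwards [h1, h2] with s hs1 hs2
    calc ‖ξ s - ξ' (f s)‖ = ‖(ξ s - η s) + (η s - ξ' (f s))‖ := by congr 1; abel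
      _ ≤ _ := norm_add_le _ _
      _ < ε := by linarith

end ContinuousField

/-! ### Hilbert–Schmidt operators -/

section HilbertSchmidt

variable {V : Type v} [NormedAddCommGroup V] [InnerProductSpace ℂ V] [CompleteSpace V]

variable (V) in
/-- The index set of an orthonormal basis of `V`. -/
noncomputable def onbIndex : Set V := (exists_hilbertBasis ℂ V).choose

variable (V) in
/-- An orthonormal basis of `V`. The quantities defined with it do not depend on the choice. -/
noncomputable def onb : HilbertBasis (onbIndex V) ℂ V := (exists_hilbertBasis ℂ V).choose_spec.choose

/-- `Tr |A|² = ∑ ‖A e_i‖²`, possibly infinite. -/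
noncomputable def traceAbsSq (A : V →L[ℂ] V) : ℝ≥0∞ := ∑' i, ‖A (onb V i)‖ₑ ^ 2

/-- The Hilbert–Schmidt norm `‖A‖₂` of a Hilbert–Schmidt operator. -/
noncomputable def hsNorm (A : V →L[ℂ] V) : ℝ := √(traceAbsSq A).toReal

/-- The inner product `⟨A, B⟩ = Tr (B* A) = ∑ ⟨A e_i, B e_i⟩` of Hilbert–Schmidt operators, linear in
`A` (Mathlib's `inner` is linear in its second argument). -/
noncomputable def hsInner (A B : V →L[ℂ] V) : ℂ := ∑' i, inner ℂ (B (onb V i)) (A (onb V i))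

end HilbertSchmidt

section Operators

variable {X : Type u} [TopologicalSpace X] {E : X → Type v}
    [∀ x, NormedAddCommGroup (E x)] [∀ x, InnerProductSpace ℂ (E x)]
    [∀ x, CompleteSpace (E x)] [∀ x, TopologicalSpace.SeparableSpace (E x)]

/-- Adjointable operators on the Hilbert `C₀(X)`-module `C₀(X, E)`, whose inner product is
`⟨ξ, η⟩ (x) = ⟨ξ x, η x⟩`. (Boundedness and `C₀(X)`-linearity are automatic.) -/
structure AdjointableOp (F : ContinuousField X E) where
  toLin : F.c0 →ₗ[ℂ] F.c0
  exists_adjoint : ∃ S : F.c0 → F.c0, ∀ (ξ η : F.c0) (x : X),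
    inner ℂ ((toLin ξ : ∀ x, E x) x) ((η : ∀ x, E x) x) =
      inner ℂ ((ξ : ∀ x, E x) x) ((S η : ∀ x, E x) x)

namespace AdjointableOp

variable [T2Space X] [LocallyCompactSpace X] {F : ContinuousField X E}

theorem eval_congr (T : AdjointableOp F) {ξ η : F.c0} {x : X}
    (h : (ξ : ∀ x, E x) x = (η : ∀ x, E x) x) :
    (T.toLin ξ : ∀ x, E x) x = (T.toLin η : ∀ x, E x) x := by
  obtain ⟨S, hS⟩ := T.exists_adjoint
  refine ext_inner_right ℂ fun w => ?_
  obtain ⟨ζ, rfl⟩ := F.exists_c0_eval x w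
  rw [hS, hS, h]

/-- An element of `C₀(X, E)` with value `w` at `x`. -/
noncomputable def lift (F : ContinuousField X E) (x : X) (w : E x) : F.c0 :=
  (F.exists_c0_eval x w).choose

theorem lift_eval (F : ContinuousField X E) (x : X) (w : E x) :
    (lift F x w : ∀ x, E x) x = w :=
  (F.exists_c0_eval x w).choose_spec

/-- The localisation `T_x`: the bounded operator on `E x` with `T_x (ξ x) = (T ξ) x`. -/
noncomputable def localization (T : AdjointableOp F) (x : X) : E x →L[ℂ] E x :=
  ContinuousLinearMap.ofSeqClosedGraph
    (g :=
      { toFun := fun w => (T.toLin (lift F x w) : ∀ x, E x) x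
        map_add' := by
          intro w w'
          have h := T.eval_congr (ξ := lift F x (w + w')) (η := lift F x w + lift F x w') (x := x)
            (by simp [lift_eval])
          rw [h, map_add]
          rfl
        map_smul' := by
          intro c w
          have h := T.eval_congr (ξ := lift F x (c • w)) (η := c • lift F x w) (x := x)
            (by simp [lift_eval])
          rw [h, map_smul]
          rfl })
    (by
      intro a w b ha hb
      obtain ⟨S, hS⟩ := T.exists_adjoint
      refine ext_inner_right ℂ fun z => ?_
      obtain ⟨ζ, rfl⟩ := F.exists_c0_eval x z
      have h1 := hb.inner (tendsto_const_nhds (x := (ζ : ∀ x, E x) x)) (𝕜 := ℂ)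
      have h2 := ha.inner (tendsto_const_nhds (x := (S ζ : ∀ x, E x) x)) (𝕜 := ℂ)
      have e : ∀ w' : E x, inner ℂ ((T.toLin (lift F x w') : ∀ x, E x) x) ((ζ : ∀ x, E x) x)
          = inner ℂ w' ((S ζ : ∀ x, E x) x) := by
        intro w'
        rw [hS, lift_eval]
      refine (tendsto_nhds_unique h1 ?_).trans (e w).symm
      exact h2.congr fun n => (e (a n)).symm)

theorem localization_apply (T : AdjointableOp F) (x : X) (ξ : F.c0) :
    T.localization x ((ξ : ∀ x, E x) x) = (T.toLin ξ : ∀ x, E x) x :=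
  T.eval_congr (lift_eval F x _)

end AdjointableOp

/-- The class `ℒ²(C₀(X, E))`: the adjointable operators `T` for which `x ↦ Tr |T_x|²` is finite and
belongs to `C₀(X)`. -/
structure HilbertSchmidtOp [T2Space X] [LocallyCompactSpace X] (F : ContinuousField X E)
    extends AdjointableOp F where
  trace_mem : ∃ f : C₀(X, ℝ), ∀ x,
    traceAbsSq (toAdjointableOp.localization x) = ENNReal.ofReal (f x)

/-- The norm `‖T‖₂ = sup_x ‖T_x‖₂` of `ℒ²(C₀(X, E))`. -/
noncomputable def HilbertSchmidtOp.norm [T2Space X] [LocallyCompactSpace X]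
    {F : ContinuousField X E} (T : HilbertSchmidtOp F) : ℝ :=
  ⨆ x, hsNorm (T.localization x)

end Operators

/-! ### Representations -/

open TopGroupoid

/-- A continuous unitary representation `π` of `G` on the continuous field `F` over `G⁰`.
The operator `π(x) : E (d x) → E (r x)` is `act x hd hr`; the equations `hd : d x = a` and
`hr : r x = b` only name the two fibres, so that composites can be written without casts. -/
structure ContUnitaryRep (G : Type u) [TopologicalSpace G] [TopGroupoid G]
    {E : unitSpace G → Type v}
    [∀ x, NormedAddCommGroup (E x)] [∀ x, InnerProductSpace ℂ (E x)]
    [∀ x, CompleteSpace (E x)] [∀ x, TopologicalSpace.SeparableSpace (E x)]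
    (F : ContinuousField (unitSpace G) E) where
  act : ∀ (x : G) {a b : unitSpace G}, dom x = a → ran x = b → (E a ≃ₗᵢ[ℂ] E b)
  act_unit : ∀ (a : unitSpace G) (w : E a), act (a : G) (dom_coe a) (ran_coe a) w = w
  act_mul : ∀ {x y : G} (h : Comp x y) {a b c : unitSpace G} (hya : dom y = a) (hyb : ran y = b)
    (hxb : dom x = b) (hxc : ran x = c) (w : E a),
    act x hxb hxc (act y hya hyb w) = act (mul x y h) ((dom_mul h).trans hya)
      ((ran_mul h).trans hxc) w
  act_inv : ∀ (x : G) {a b : unitSpace G} (ha : dom x = a) (hb : ran x = b),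
    (act x ha hb).symm = act (inv x) ((dom_inv x).trans hb) ((ran_inv x).trans ha)
  continuous_coeff : ∀ ξ ∈ F.c0, ∀ η ∈ F.c0,
    Continuous fun x : G => inner ℂ (act x rfl rfl (ξ (dom x))) (η (ran x))

namespace ContUnitaryRep

variable {G : Type u} [TopologicalSpace G] [TopGroupoid G] {E : unitSpace G → Type v}
    [∀ x, NormedAddCommGroup (E x)] [∀ x, InnerProductSpace ℂ (E x)]
    [∀ x, CompleteSpace (E x)] [∀ x, TopologicalSpace.SeparableSpace (E x)]
    [T2Space G] [LocallyCompactSpace G] {F : ContinuousField (unitSpace G) E}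

/-- The operator `x · A = π(x) A π(x⁻¹)` on the fibre over `r x`, for `A` on the fibre over `d x`. -/
noncomputable def conj (π : ContUnitaryRep G F) (x : G) (A : E (dom x) →L[ℂ] E (dom x)) :
    E (ran x) →L[ℂ] E (ran x) :=
  (π.act x rfl rfl).toContinuousLinearEquiv.toContinuousLinearMap ∘L A ∘L
    (π.act (inv x) (dom_inv x) (ran_inv x)).toContinuousLinearEquiv.toContinuousLinearMap

/-- Amenability of `π`: there is a net `T` of Hilbert–Schmidt operators on `C₀(G⁰, E)` with
`‖T i‖₂ ≤ 1`, `‖(T i)_a‖₂ → 1` uniformly on compact subsets of `G⁰`, and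
`⟨x · (T i)_{d x}, (T i)_{r x}⟩ → 1` uniformly on compact subsets of `G`. -/
def IsAmenable (π : ContUnitaryRep G F) : Prop :=
  ∃ (I : Type u) (_ : Preorder I) (_ : IsDirectedOrder I) (_ : Nonempty I)
    (T : I → HilbertSchmidtOp F),
    (∀ i, (T i).norm ≤ 1) ∧
    (∀ K : Set (unitSpace G), IsCompact K →
      TendstoUniformlyOn (fun i a => hsNorm ((T i).localization a)) (fun _ => 1) atTop K) ∧
    (∀ K : Set G, IsCompact K →
      TendstoUniformlyOn
        (fun i x => hsInner (π.conj x ((T i).localization (dom x))) ((T i).localization (ran x)))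
        (fun _ => 1) atTop K)

/-- Coefficients of `π` with respect to arbitrary continuous sections are continuous. -/
theorem continuous_coeff_sections (π : ContUnitaryRep G F) {ξ η : ∀ a, E a}
    (hξ : ξ ∈ F.sections) (hη : η ∈ F.sections) :
    Continuous fun x : G => inner ℂ (π.act x rfl rfl (ξ (dom x))) (η (ran x)) := by
  refine continuous_iff_continuousAt.2 fun x => ?_
  obtain ⟨ξ', hξ', h1⟩ := F.exists_c0_eventuallyEq hξ (dom x)
  obtain ⟨η', hη', h2⟩ := F.exists_c0_eventuallyEq hη (ran x)
  refine (π.continuous_coeff ξ' hξ' η' hη').continuousAt.congr ?_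
  filter_upwards [continuous_dom.continuousAt.eventually h1,
    continuous_ran.continuousAt.eventually h2] with y hy1 hy2
  rw [hy1, hy2]

/-- The restriction `π|_H` of `π` to a closed subgroupoid `H`, acting on the reduction of the field
to the unit space of `H`. -/
def restrict (π : ContUnitaryRep G F) (H : ClosedSubgroupoid G) :
    ContUnitaryRep H (F.pullback H.unitIncl H.continuous_unitIncl) where
  act x _ _ ha hb := π.act (x : G) (congrArg H.unitIncl ha) (congrArg H.unitIncl hb)
  act_unit a w := π.act_unit (H.unitIncl a) w
  act_mul h _ _ _ _ _ _ _ w := π.act_mul h _ _ _ _ w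
  act_inv x _ _ _ _ := π.act_inv (x : G) _ _
  continuous_coeff := by
    rintro ξ ⟨hξ, -⟩ η ⟨hη, -⟩
    refine continuous_of_locally_uniform_approx_of_continuousAt fun x U hU => ?_
    obtain ⟨ε, hε, hεU⟩ := Metric.mem_uniformity_dist.1 hU
    have hnξ := (F.pullback H.unitIncl H.continuous_unitIncl).continuous_norm ξ hξ
    have hnη := (F.pullback H.unitIncl H.continuous_unitIncl).continuous_norm η hη
    set M : ℝ := max ‖ξ (dom x)‖ ‖η (ran x)‖ + 1 with hM
    have hM1 : 1 ≤ M := by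
      have : 0 ≤ max ‖ξ (dom x)‖ ‖η (ran x)‖ := le_max_of_le_left (norm_nonneg _)
      linarith
    obtain ⟨δ, hδ, hδ1, hδε⟩ : ∃ δ : ℝ, 0 < δ ∧ δ ≤ 1 ∧ δ * (2 * M + 1) < ε := by
      refine ⟨min 1 (ε / (2 * (2 * M + 1))), by positivity, min_le_left _ _, ?_⟩
      calc min 1 (ε / (2 * (2 * M + 1))) * (2 * M + 1)
          ≤ ε / (2 * (2 * M + 1)) * (2 * M + 1) :=
            mul_le_mul_of_nonneg_right (min_le_right _ _) (by linarith)
        _ = ε / 2 := by field_simp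
        _ < ε := half_lt_self hε
    obtain ⟨ξ', hξ', h1⟩ := hξ (dom x) δ hδ
    obtain ⟨η', hη', h2⟩ := hη (ran x) δ hδ
    have h3 : ∀ᶠ a in 𝓝 (dom x), ‖ξ a‖ < M :=
      hnξ.continuousAt.eventually_lt continuousAt_const
        ((le_max_left _ _).trans_lt (lt_add_one _))
    have h4 : ∀ᶠ a in 𝓝 (ran x), ‖η a‖ < M :=
      hnη.continuousAt.eventually_lt continuousAt_const
        ((le_max_right _ _).trans_lt (lt_add_one _))
    refine ⟨{y | (‖ξ (dom y) - ξ' (H.unitIncl (dom y))‖ < δ ∧ ‖ξ (dom y)‖ < M) ∧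
        (‖η (ran y) - η' (H.unitIncl (ran y))‖ < δ ∧ ‖η (ran y)‖ < M)},
      (continuous_dom.continuousAt.eventually (h1.and h3)).and
        (continuous_ran.continuousAt.eventually (h2.and h4)),
      fun y : H => inner ℂ (π.act (y : G) rfl rfl (ξ' (dom (y : G)))) (η' (ran (y : G))),
      ((π.continuous_coeff_sections hξ' hη').comp continuous_subtype_val).continuousAt, ?_⟩
    rintro y ⟨⟨a1, a2⟩, a3, a4⟩
    refine hεU ?_
    have key : ∀ (p p' : E (dom (y : G))) (q q' : E (ran (y : G))),
        ‖p - p'‖ < δ → ‖p‖ < M → ‖q - q'‖ < δ → ‖q‖ < M →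
        dist (inner ℂ (π.act (y : G) rfl rfl p) q) (inner ℂ (π.act (y : G) rfl rfl p') q') < ε := by
      intro p p' q q' b1 b2 b3 b4
      have e : inner ℂ (π.act (y : G) rfl rfl p) q - inner ℂ (π.act (y : G) rfl rfl p') q' =
          inner ℂ (π.act (y : G) rfl rfl (p - p')) q' +
            inner ℂ (π.act (y : G) rfl rfl p) (q - q') := by
        rw [map_sub, inner_sub_left, inner_sub_right]; ring
      have hq' : ‖q'‖ ≤ M + 1 := by
        have := norm_sub_norm_le q' q
        rw [norm_sub_rev] at this
        linarith
      rw [dist_eq_norm, e]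
      calc _ ≤ ‖p - p'‖ * ‖q'‖ + ‖p‖ * ‖q - q'‖ := by
            refine (norm_add_le _ _).trans (add_le_add ?_ ?_)
            · exact (norm_inner_le_norm (𝕜 := ℂ) _ _).trans_eq
                (congrArg (· * ‖q'‖) (LinearIsometryEquiv.norm_map _ _))
            · exact (norm_inner_le_norm (𝕜 := ℂ) _ _).trans_eq
                (congrArg (· * ‖q - q'‖) (LinearIsometryEquiv.norm_map _ _))
        _ ≤ δ * (M + 1) + M * δ := by gcongr
        _ = δ * (2 * M + 1) := by ring
        _ < ε := hδε
    exact key _ _ _ _ a1 a2 a3 a4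

end ContUnitaryRep

/-! ### The operator norm and the Hilbert–Schmidt norm -/

section HilbertSchmidtBounds

variable {V : Type v} [NormedAddCommGroup V] [InnerProductSpace ℂ V] [CompleteSpace V]

/-! The inclusion of `H⁰` in `G⁰` is a closed embedding, and the net that witnesses amenability of
`π` is reduced along it without any change in the fibres. The reduced operators have the
localizations of the original ones at the points of `H⁰`, so the norm bound and both limits are
inherited: compact subsets of `H⁰` and `H` map to compact subsets of `G⁰` and `G`.

The work lies in reducing an operator `T`. A section of the reduced field is by definition only
locally a uniform limit of restricted sections, so `T` is applied fibre by fibre, and a uniform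
bound on `‖T_x‖` is needed for this to preserve such limits. The bound holds because the operator
norm is at most the Hilbert–Schmidt norm, and `Tr |T_x|²` is bounded, being in `C₀`. The fibrewise
adjoints obey the same bound, hence give an adjoint (`apply_mem_pullback_c0` serves both).
Properness of a closed embedding keeps the trace function in `C₀`.

For countable generation (`CountablyGenerated.pullback`) the restricted generators suffice:
combinations that approximate a section locally are glued by a partition of unity. -/

/-- Expand `w` in the orthonormal basis. Cauchy–Schwarz and Bessel bound the image of every finite
partial sum, and the bound passes to the limit. -/
theorem opNorm_le_sqrt_of_traceAbsSq_le {A : V →L[ℂ] V} {c : ℝ}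
    (h : traceAbsSq A ≤ ENNReal.ofReal c) : ‖A‖ ≤ √c := by
  refine A.opNorm_le_bound (Real.sqrt_nonneg c) fun w => ?_
  -- `c` may be negative, in which case `ENNReal.ofReal c = 0`; hence `max c 0`. Likewise `√c = 0`
  -- then, so the two agree at the end.
  have hfin : ∀ s : Finset (onbIndex V), ∑ i ∈ s, ‖A (onb V i)‖ ^ 2 ≤ max c 0 := by
    intro s
    have h1 := (ENNReal.sum_le_tsum s (f := fun i => ‖A (onb V i)‖ₑ ^ 2)).trans h
    have h2 : ∑ i ∈ s, ‖A (onb V i)‖ₑ ^ 2 = ENNReal.ofReal (∑ i ∈ s, ‖A (onb V i)‖ ^ 2) := by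
      rw [ENNReal.ofReal_sum_of_nonneg fun i _ => by positivity]
      refine Finset.sum_congr rfl fun i _ => ?_
      rw [ENNReal.ofReal_pow (norm_nonneg _), ofReal_norm]
    rw [h2] at h1
    exact (ENNReal.ofReal_le_ofReal_iff'.1 h1).elim (fun h => h.trans (le_max_left _ _))
      fun h => h.trans (le_max_right _ _)
  have hsum := ((onb V).hasSum_repr w).mapL A
  refine le_of_tendsto hsum.norm (Eventually.of_forall fun s => ?_)
  have hbessel : ∑ i ∈ s, ‖(onb V).repr w i‖ ^ 2 ≤ ‖w‖ ^ 2 := by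
    simpa only [HilbertBasis.repr_apply_apply] using
      (onb V).orthonormal.sum_inner_products_le (s := s) w
  calc ‖∑ i ∈ s, A ((onb V).repr w i • onb V i)‖
      ≤ ∑ i ∈ s, ‖A (onb V i)‖ * ‖(onb V).repr w i‖ := by
        refine (norm_sum_le _ _).trans (Finset.sum_le_sum fun i _ => ?_)
        rw [map_smul, norm_smul, mul_comm]
    _ ≤ √(∑ i ∈ s, ‖A (onb V i)‖ ^ 2) * √(∑ i ∈ s, ‖(onb V).repr w i‖ ^ 2) :=
        Real.sum_mul_le_sqrt_mul_sqrt _ _ _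
    _ ≤ √(max c 0) * √(‖w‖ ^ 2) := by gcongr; exact hfin s
    _ = √c * ‖w‖ := by
        rw [Real.sqrt_sq (norm_nonneg w)]
        congr 1
        rcases le_total c 0 with hc | hc
        · rw [max_eq_right hc, Real.sqrt_zero, Real.sqrt_eq_zero_of_nonpos hc]
        · rw [max_eq_left hc]

theorem hsNorm_le_sqrt_of_traceAbsSq_le {A : V →L[ℂ] V} {c : ℝ} (hc : 0 ≤ c)
    (h : traceAbsSq A ≤ ENNReal.ofReal c) : hsNorm A ≤ √c :=
  Real.sqrt_le_sqrt (ENNReal.toReal_le_of_le_ofReal hc h)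

end HilbertSchmidtBounds

namespace HilbertSchmidtOp

variable {X : Type u} [TopologicalSpace X] [T2Space X] [LocallyCompactSpace X] {E : X → Type v}
    [∀ x, NormedAddCommGroup (E x)] [∀ x, InnerProductSpace ℂ (E x)]
    [∀ x, CompleteSpace (E x)] [∀ x, TopologicalSpace.SeparableSpace (E x)]
    {F : ContinuousField X E}

theorem exists_traceAbsSq_le (T : HilbertSchmidtOp F) :
    ∃ C : ℝ, 0 ≤ C ∧ ∀ x, traceAbsSq (T.localization x) ≤ ENNReal.ofReal C := by
  obtain ⟨f, hf⟩ := T.trace_mem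
  refine ⟨‖f.toBCF‖, norm_nonneg _, fun x => ?_⟩
  rw [hf]
  exact ENNReal.ofReal_le_ofReal ((le_abs_self _).trans (f.toBCF.norm_coe_le_norm x))

/-- This uniform bound is what carries local approximations of sections through the localizations.
-/
theorem exists_opNorm_localization_le (T : HilbertSchmidtOp F) :
    ∃ C : ℝ, ∀ x, ‖T.localization x‖ ≤ C := by
  obtain ⟨C, -, h⟩ := T.exists_traceAbsSq_le
  exact ⟨√C, fun x => opNorm_le_sqrt_of_traceAbsSq_le (h x)⟩

theorem hsNorm_localization_le_norm (T : HilbertSchmidtOp F) (x : X) :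
    hsNorm (T.localization x) ≤ T.norm := by
  obtain ⟨C, hC, h⟩ := T.exists_traceAbsSq_le
  -- A real supremum dominates its terms only when the family is bounded above; `√C` is such a
  -- bound.
  refine le_ciSup (f := fun x => hsNorm (T.localization x)) ⟨√C, ?_⟩ x
  rintro _ ⟨y, rfl⟩
  exact hsNorm_le_sqrt_of_traceAbsSq_le hC (h y)

end HilbertSchmidtOp

/-! ### Reduction of a continuous field along a closed embedding -/

namespace ContinuousField

variable {X : Type u} [TopologicalSpace X] {E : X → Type v}
    [∀ x, NormedAddCommGroup (E x)] [∀ x, InnerProductSpace ℂ (E x)]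
    [∀ x, CompleteSpace (E x)] [∀ x, TopologicalSpace.SeparableSpace (E x)]
    {Y : Type u} [TopologicalSpace Y] {f : Y → X}

theorem comp_mem_pullback (F : ContinuousField X E) (hf : Continuous f) {ξ : ∀ x, E x}
    (hξ : ξ ∈ F.sections) : (fun y => ξ (f y)) ∈ (F.pullback f hf).sections :=
  fun _ _ hε => ⟨ξ, hξ, by simpa using hε⟩

theorem comp_mem_pullback_c0 (F : ContinuousField X E) (hf : IsClosedEmbedding f)
    {ξ : ∀ x, E x} (hξ : ξ ∈ F.c0) : (fun y => ξ (f y)) ∈ (F.pullback f hf.continuous).c0 :=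
  ⟨F.comp_mem_pullback hf.continuous hξ.1, hξ.2.comp hf.tendsto_cocompact⟩

/-- A section of the pullback is locally approximated by sections vanishing at infinity. -/
theorem exists_c0_approx [T2Space X] [LocallyCompactSpace X] (F : ContinuousField X E)
    (hf : Continuous f) {ξ : ∀ y, E (f y)} (hξ : ξ ∈ (F.pullback f hf).sections) (y : Y) {ε : ℝ}
    (hε : 0 < ε) : ∃ ξ' : F.c0, ∀ᶠ s in 𝓝 y, ‖ξ s - (ξ' : ∀ x, E x) (f s)‖ < ε := by
  obtain ⟨η, hη, h1⟩ := hξ y ε hε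
  obtain ⟨ξ', hξ', h2⟩ := F.exists_c0_eventuallyEq hη (f y)
  refine ⟨⟨ξ', hξ'⟩, ?_⟩
  filter_upwards [h1, hf.continuousAt.eventually h2] with s hs1 hs2
  simpa only [hs2] using hs1

/-- A bounded family of operators that preserves `C₀(X, E)` preserves the sections of the pullback
that vanish at infinity. -/
theorem apply_mem_pullback_c0 [T2Space X] [LocallyCompactSpace X] (F : ContinuousField X E)
    (hf : Continuous f) {A : ∀ x, E x →L[ℂ] E x} {C : ℝ} (hA : ∀ x, ‖A x‖ ≤ C)
    (hmem : ∀ ξ ∈ F.c0, (fun x => A x (ξ x)) ∈ F.c0) {ξ : ∀ y, E (f y)}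
    (hξ : ξ ∈ (F.pullback f hf).c0) : (fun y => A (f y) (ξ y)) ∈ (F.pullback f hf).c0 := by
  refine ⟨fun y ε hε => ?_, ?_⟩
  -- `|C| + 1` is a positive bound for all the operators; `C` itself may be zero, or even negative
  -- if `X` is empty.
  · obtain ⟨ξ', h⟩ := F.exists_c0_approx hf hξ.1 y (ε := ε / (|C| + 1)) (by positivity)
    refine ⟨_, (hmem ξ' ξ'.2).1, ?_⟩
    filter_upwards [h] with s hs
    rw [← map_sub]
    calc _ ≤ ‖A (f s)‖ * ‖ξ s - (ξ' : ∀ x, E x) (f s)‖ := (A (f s)).le_opNorm _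
      _ ≤ (|C| + 1) * ‖ξ s - (ξ' : ∀ x, E x) (f s)‖ := by
          gcongr
          exact (hA _).trans ((le_abs_self C).trans (by linarith))
      _ < ε := by rwa [lt_div_iff₀' (by positivity)] at hs
  · refine squeeze_zero (fun y => norm_nonneg _)
      (fun y => ((A (f y)).le_opNorm _).trans
        (mul_le_mul_of_nonneg_right (hA _) (norm_nonneg _))) ?_
    simpa using hξ.2.const_mul C

/-- Near each point, `ξ` is close to the restriction of a `C₀` section, hence to a combination of
restricted generators. Finitely many such patches cover a compact set outside which `‖ξ‖ < ε`, and a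
compactly supported partition of unity averages them without increasing the error. -/
theorem CountablyGenerated.pullback [T2Space X] [LocallyCompactSpace X] [T2Space Y]
    [LocallyCompactSpace Y] {F : ContinuousField X E} (hF : F.CountablyGenerated)
    (hf : IsClosedEmbedding f) : (F.pullback f hf.continuous).CountablyGenerated := by
  obtain ⟨e, he⟩ := hF
  refine ⟨fun i => ⟨_, F.comp_mem_pullback_c0 hf (e i).2⟩, fun ξ ε hε => ?_⟩
  let φ : CocompactMap Y X := ⟨⟨f, hf.continuous⟩, hf.tendsto_cocompact⟩
  have hloc : ∀ y, ∃ (N : ℕ) (g : ℕ → C₀(Y, ℂ)) (U : Set Y), IsOpen U ∧ y ∈ U ∧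
      ∀ s ∈ U, ‖(ξ : ∀ y, E (f y)) s -
        ∑ i ∈ Finset.range N, g i s • (e i : ∀ x, E x) (f s)‖ ≤ ε := by
    intro y
    obtain ⟨ξ', h⟩ := F.exists_c0_approx hf.continuous ξ.2.1 y (half_pos hε)
    obtain ⟨N, g, hg⟩ := he ξ' (ε / 2) (half_pos hε)
    obtain ⟨U, hU, hUo, hyU⟩ := mem_nhds_iff.1 h
    refine ⟨N, fun i => (g i).comp φ, U, hUo, hyU, fun s hs => ?_⟩
    refine (norm_sub_le_norm_sub_add_norm_sub _ ((ξ' : ∀ x, E x) (f s)) _).trans ?_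
    have h1 : ‖(ξ : ∀ y, E (f y)) s - (ξ' : ∀ x, E x) (f s)‖ < ε / 2 := hU hs
    have h2 := hg (f s)
    exact (add_le_add h1.le h2).trans_eq (add_halves ε)
  choose N g U hUo hyU hU using hloc
  obtain ⟨K, hK, hKξ⟩ := mem_cocompact.1 (ξ.2.2.eventually (gt_mem_nhds hε))
  obtain ⟨t, ht⟩ := hK.elim_finite_subcover U hUo fun y _ => mem_iUnion.2 ⟨y, hyU y⟩
  obtain ⟨ρ, hρU, hρc⟩ := PartitionOfUnity.exists_isSubordinate_of_locallyFinite_t2space hK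
    (fun y : t => U y) (fun y => hUo y) (locallyFinite_of_finite _)
    (by simpa [iUnion_subtype] using ht)
  let ρ' : t → C₀(Y, ℂ) := fun j =>
    ⟨⟨fun s => ((ρ j s : ℝ) : ℂ), Complex.continuous_ofReal.comp (ρ j).continuous⟩, by
      refine tendsto_const_nhds.congr' ?_
      filter_upwards [(hρc j).isCompact.compl_mem_cocompact] with s hs
      simp [image_eq_zero_of_notMem_tsupport hs]⟩
  have hρ' : ∀ j s, ρ' j s = ((ρ j s : ℝ) : ℂ) := fun j s => rfl
  -- The patches use different numbers of generators: `M` is a common length, and the coefficients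
  -- of patch `j` are cut off from `N j` on.
  let M := t.sup N
  let h : ℕ → C₀(Y, ℂ) := fun i => ∑ j : t, ρ' j * (if i < N j then g j i else 0)
  have hh : ∀ i s, h i s = ∑ j : t, (ρ j s : ℂ) * (if i < N j then g j i s else 0) := by
    intro i s
    have hsum : ∀ a : Finset t, (∑ j ∈ a, ρ' j * (if i < N j then g j i else 0) : C₀(Y, ℂ)) s
        = ∑ j ∈ a, (ρ j s : ℂ) * (if i < N j then g j i s else 0) := by
      intro a
      induction a using Finset.cons_induction with
      | empty => rfl
      | cons j a hj ih =>
        rw [Finset.sum_cons, Finset.sum_cons, ZeroAtInftyContinuousMap.add_apply, ih,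
          ZeroAtInftyContinuousMap.mul_apply, hρ']
        split_ifs <;> rfl
    exact hsum _
  refine ⟨M, h, fun s => ?_⟩
  let ζ : t → E (f s) := fun j => ∑ i ∈ Finset.range (N j), g j i s • (e i : ∀ x, E x) (f s)
  have hζ : ∑ i ∈ Finset.range M, h i s • (e i : ∀ x, E x) (f s) = ∑ j : t, (ρ j s : ℂ) • ζ j := by
    simp only [hh, Finset.sum_smul]
    rw [Finset.sum_comm]
    refine Finset.sum_congr rfl fun j _ => ?_
    simp only [mul_smul]
    rw [← Finset.smul_sum]
    congr 1
    simp only [ζ, ite_smul, zero_smul]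
    rw [← Finset.sum_filter]
    refine Finset.sum_congr ?_ fun _ _ => rfl
    ext i
    have hNM : N j ≤ M := Finset.le_sup (f := N) j.2
    simp only [Finset.mem_filter, Finset.mem_range]
    omega
  have hle : ∑ j : t, ρ j s ≤ 1 := by
    rw [← finsum_eq_sum_of_fintype]; exact ρ.sum_le_one s
  have hr : (∑ j : t, (ρ j s : ℂ)) = ((∑ j : t, ρ j s : ℝ) : ℂ) := by push_cast; rfl
  -- The weight missing from the partition falls on `ξ s` itself. It vanishes on `K`, and off `K`
  -- the section is smaller than `ε`, so the error is a convex combination of terms bounded by `ε`.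
  have hdec : (ξ : ∀ y, E (f y)) s - ∑ j : t, (ρ j s : ℂ) • ζ j =
      ((1 - ∑ j : t, ρ j s : ℝ) : ℂ) • (ξ : ∀ y, E (f y)) s +
        ∑ j : t, (ρ j s : ℂ) • ((ξ : ∀ y, E (f y)) s - ζ j) := by
    simp only [smul_sub, Finset.sum_sub_distrib]
    rw [← Finset.sum_smul, hr]
    push_cast
    rw [sub_smul, one_smul]
    abel
  change ‖(ξ : ∀ y, E (f y)) s - ∑ i ∈ Finset.range M, h i s • (e i : ∀ x, E x) (f s)‖ ≤ ε
  rw [hζ, hdec]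
  have h1 : ‖((1 - ∑ j : t, ρ j s : ℝ) : ℂ) • (ξ : ∀ y, E (f y)) s‖ ≤
      (1 - ∑ j : t, ρ j s) * ε := by
    rw [norm_smul, Complex.norm_real, Real.norm_of_nonneg (sub_nonneg.2 hle)]
    by_cases hs : s ∈ K
    · have : ∑ j : t, ρ j s = 1 := by
        rw [← finsum_eq_sum_of_fintype]; exact ρ.sum_eq_one hs
      rw [this, sub_self, zero_mul, zero_mul]
    · exact mul_le_mul_of_nonneg_left (le_of_lt (hKξ hs)) (sub_nonneg.2 hle)
  have h2 : ∀ j : t, ‖(ρ j s : ℂ) • ((ξ : ∀ y, E (f y)) s - ζ j)‖ ≤ ρ j s * ε := by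
    intro j
    rw [norm_smul, Complex.norm_real, Real.norm_of_nonneg (ρ.nonneg j s)]
    -- The estimate for `ζ j` is available only on `U j`; elsewhere subordination makes `ρ j`
    -- vanish.
    by_cases hs : s ∈ U j
    · exact mul_le_mul_of_nonneg_left (hU j s hs) (ρ.nonneg j s)
    · rw [image_eq_zero_of_notMem_tsupport fun h => hs (hρU j h), zero_mul, zero_mul]
  calc _ ≤ (1 - ∑ j : t, ρ j s) * ε + ∑ j : t, ρ j s * ε :=
        (norm_add_le _ _).trans (add_le_add h1
          ((norm_sum_le _ _).trans (Finset.sum_le_sum fun j _ => h2 j)))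
    _ = ε := by rw [← Finset.sum_mul]; ring

end ContinuousField

/-! ### Reduction of Hilbert–Schmidt operators -/

namespace HilbertSchmidtOp

variable {X : Type u} [TopologicalSpace X] [T2Space X] [LocallyCompactSpace X] {E : X → Type v}
    [∀ x, NormedAddCommGroup (E x)] [∀ x, InnerProductSpace ℂ (E x)]
    [∀ x, CompleteSpace (E x)] [∀ x, TopologicalSpace.SeparableSpace (E x)]
    {F : ContinuousField X E}
    {Y : Type u} [TopologicalSpace Y] {f : Y → X}

theorem localization_mem_pullback_c0 (T : HilbertSchmidtOp F) (hf : Continuous f)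
    {ξ : ∀ y, E (f y)} (hξ : ξ ∈ (F.pullback f hf).c0) :
    (fun y => T.localization (f y) (ξ y)) ∈ (F.pullback f hf).c0 := by
  obtain ⟨C, hC⟩ := T.exists_opNorm_localization_le
  refine F.apply_mem_pullback_c0 hf hC (fun ξ hξ => ?_) hξ
  convert (T.toLin ⟨ξ, hξ⟩).2 using 1
  exact funext fun x => T.localization_apply x ⟨ξ, hξ⟩

theorem adjoint_localization_mem_pullback_c0 (T : HilbertSchmidtOp F) (hf : Continuous f)
    {ξ : ∀ y, E (f y)} (hξ : ξ ∈ (F.pullback f hf).c0) :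
    (fun y => ContinuousLinearMap.adjoint (T.localization (f y)) (ξ y)) ∈
      (F.pullback f hf).c0 := by
  obtain ⟨C, hC⟩ := T.exists_opNorm_localization_le
  refine F.apply_mem_pullback_c0 hf (A := fun x => ContinuousLinearMap.adjoint (T.localization x))
    (C := C) (fun x => ?_) (fun ξ hξ => ?_) hξ
  · rw [LinearIsometryEquiv.norm_map]
    exact hC x
  · obtain ⟨S, hS⟩ := T.exists_adjoint
    -- The adjoint `S` of `T` acts fibrewise as the adjoint of `T_x`: the two have equal inner
    -- products with every value of a `C₀` section, and these values fill the fibre.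
    convert (S ⟨ξ, hξ⟩).2 using 1
    funext x
    refine ext_inner_left ℂ fun w => ?_
    obtain ⟨ζ, rfl⟩ := F.exists_c0_eval x w
    rw [ContinuousLinearMap.adjoint_inner_right, T.localization_apply]
    exact hS ζ ⟨ξ, hξ⟩ x

/-- The operator on the sections of the pullback with the same localizations as `T`. -/
noncomputable def pullbackAdjointable (T : HilbertSchmidtOp F) (hf : Continuous f) :
    AdjointableOp (F.pullback f hf) where
  toLin :=
    { toFun := fun ξ => ⟨_, T.localization_mem_pullback_c0 hf ξ.2⟩
      map_add' := fun _ _ => Subtype.ext <| funext fun y => map_add (T.localization (f y)) _ _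
      map_smul' := fun c _ => Subtype.ext <| funext fun y => map_smul (T.localization (f y)) c _ }
  exists_adjoint := ⟨fun ξ => ⟨_, T.adjoint_localization_mem_pullback_c0 hf ξ.2⟩, fun _ _ y =>
    (ContinuousLinearMap.adjoint_inner_right (T.localization (f y)) _ _).symm⟩

/-- Both operators act on the same space `E (f y)`, so traces, norms and pairings over `y` are
literally those over `f y`, computed in the same orthonormal basis. -/
theorem pullbackAdjointable_localization [T2Space Y] [LocallyCompactSpace Y]
    (T : HilbertSchmidtOp F) (hf : Continuous f) (y : Y) :
    (T.pullbackAdjointable hf).localization y = T.localization (f y) := by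
  ext w
  obtain ⟨ξ, rfl⟩ := (F.pullback f hf).exists_c0_eval y w
  exact (T.pullbackAdjointable hf).localization_apply y ξ

/-- The reduction of a Hilbert–Schmidt operator along a closed embedding. -/
noncomputable def pullback [T2Space Y] [LocallyCompactSpace Y] (T : HilbertSchmidtOp F)
    (hf : IsClosedEmbedding f) : HilbertSchmidtOp (F.pullback f hf.continuous) where
  toAdjointableOp := T.pullbackAdjointable hf.continuous
  trace_mem := by
    obtain ⟨g, hg⟩ := T.trace_mem
    refine ⟨g.comp ⟨⟨f, hf.continuous⟩, hf.tendsto_cocompact⟩, fun y => ?_⟩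
    rw [pullbackAdjointable_localization]
    exact hg (f y)

theorem pullback_localization [T2Space Y] [LocallyCompactSpace Y] (T : HilbertSchmidtOp F)
    (hf : IsClosedEmbedding f) (y : Y) :
    (T.pullback hf).localization y = T.localization (f y) :=
  T.pullbackAdjointable_localization hf.continuous y

theorem pullback_norm_le_one [T2Space Y] [LocallyCompactSpace Y] {T : HilbertSchmidtOp F}
    (hT : T.norm ≤ 1) (hf : IsClosedEmbedding f) : (T.pullback hf).norm ≤ 1 := by
  -- `0 ≤ 1` covers empty `Y`, where the supremum is `0`; `H⁰` may be empty.
  refine Real.iSup_le (fun y => ?_) zero_le_one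
  rw [pullback_localization]
  exact (T.hsNorm_localization_le_norm (f y)).trans hT

end HilbertSchmidtOp

/-! ### Restriction to a closed subgroupoid -/

/-- `H⁰` is closed in the Hausdorff space `H`, and `H` is closed in `G`; the composite closed
embedding factors through the embedding of `G⁰` in `G`. -/
theorem TopGroupoid.ClosedSubgroupoid.isClosedEmbedding_unitIncl {G : Type u} [TopologicalSpace G]
    [TopGroupoid G] [T2Space G] (H : ClosedSubgroupoid G) : IsClosedEmbedding H.unitIncl := by
  have h : IsClosedEmbedding (Subtype.val ∘ H.unitIncl) :=
    H.isClosed_carrier.isClosedEmbedding_subtypeVal.comp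
      (isClosed_unitSpace (G := H)).isClosedEmbedding_subtypeVal
  exact h.of_comp IsEmbedding.subtypeVal

theorem ContUnitaryRep.IsAmenable.restrict {G : Type u} [TopologicalSpace G] [TopGroupoid G]
    [T2Space G] [LocallyCompactSpace G] {E : TopGroupoid.unitSpace G → Type v}
    [∀ a, NormedAddCommGroup (E a)] [∀ a, InnerProductSpace ℂ (E a)]
    [∀ a, CompleteSpace (E a)] [∀ a, TopologicalSpace.SeparableSpace (E a)]
    {F : ContinuousField (TopGroupoid.unitSpace G) E} {π : ContUnitaryRep G F}
    (hπ : π.IsAmenable) (H : TopGroupoid.ClosedSubgroupoid G) : (π.restrict H).IsAmenable := by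
  obtain ⟨I, hI, hI1, hI2, T, hT, hK0, hK⟩ := hπ
  have hf := H.isClosedEmbedding_unitIncl
  refine ⟨I, hI, hI1, hI2, fun i => (T i).pullback hf,
    fun i => HilbertSchmidtOp.pullback_norm_le_one (hT i) hf, fun K hKc => ?_, fun K hKc => ?_⟩
  · simp only [HilbertSchmidtOp.pullback_localization]
    exact ((hK0 _ (hKc.image hf.continuous)).comp H.unitIncl).mono (subset_preimage_image _ _)
  · simp only [HilbertSchmidtOp.pullback_localization]
    -- Conjugation by `x` in `π.restrict H` is by definition conjugation by `(x : G)` in `π`, so the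
    -- limit on the image of `K` in `G` is the one required.
    exact ((hK _ (hKc.image continuous_subtype_val)).comp ((↑) : H → G)).mono
      (subset_preimage_image _ _)

theorem proposition3p4 {G : Type u} [TopologicalSpace G] [TopGroupoid G]
    [T2Space G] [LocallyCompactSpace G] [SecondCountableTopology G]
    {E : TopGroupoid.unitSpace G → Type v}
    [∀ a, NormedAddCommGroup (E a)] [∀ a, InnerProductSpace ℂ (E a)]
    [∀ a, CompleteSpace (E a)] [∀ a, TopologicalSpace.SeparableSpace (E a)]
    (F : ContinuousField (TopGroupoid.unitSpace G) E) (hF : F.CountablyGenerated)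
    (π : ContUnitaryRep G F) (hπ : π.IsAmenable) (H : TopGroupoid.ClosedSubgroupoid G) :
    (F.pullback H.unitIncl H.continuous_unitIncl).CountablyGenerated ∧
      (π.restrict H).IsAmenable :=
  ⟨hF.pullback H.isClosedEmbedding_unitIncl, hπ.restrict H⟩
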